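/- Let $c>0$ and $f(x)=e^{cx}-1$. There are $n$ bidders; bidder $i$ has private value $v_i\in\mathbb R$, and bids are nonnegative reals. At a bid vector $\mathbf b=(b_1,\dots,b_n)$ bidder $i$ receives the allocation $a_i(\mathbf b)=f(b_i)/\sum_{j} f(b_j)$ and has utility $u_i(\mathbf b)=(v_i-b_i)\,a_i(\mathbf b)$. A best response of bidder $i$ to $\mathbf b$ is a bid $x\ge 0$ that maximizes the utility of bidder $i$ over all nonnegative bids when the other bidders keep their bids $b_j$, $j\neq i$; when it is unique it is denoted $\mathrm{BR}_i(\mathbf b)$, and $\mathbf{BR}(\mathbf b)=(\mathrm{BR}_1(\mathbf b),\dots,\mathrm{BR}_n(\mathbf b))$. Suppose $\mathbf w=(w_1,\dots,w_n)$ is a vector of nonnegative bids, at least two of them positive, such that $$\forall i:\quad w_i\le v_i-\frac1c\left(1-\frac1{e^{cw_i}}\right)\left(\frac1{1-a_i(\mathbf w)}\right).$$ Then every bidder has a unique best response to every $\mathbf b\in[w_1,v_1]\times\dots\times[w_n,v_n]$, so that $\mathbf{BR}$ is well defined on this box, and $$\exists\,\mathbf b^*\in[w_1,v_1]\times\dots\times[w_n,v_n]:\quad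 \mathbf{BR}(\mathbf b^*)=\mathbf b^*.$$ Such a $\mathbf b^*$ can be taken to be a pure-strategy Nash equilibrium: no bidder can increase their utility by unilaterally changing to another nonnegative bid. In particular a pure-strategy Nash equilibrium exists. -/

import Mathlib

namespace QuasiProportional

/-- The exponential weight function `f(x) = e^{cx} - 1` with steepness parameter `c`. -/
noncomputable def weight (c x : ℝ) : ℝ := Real.exp (c * x) - 1

/-- The share of the allocation awarded to bidder `i` at the bid vector `b`. -/
noncomputable def alloc {n : ℕ} (c : ℝ) (b : Fin n → ℝ) (i : Fin n) : ℝ :=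
  weight c (b i) / ∑ j, weight c (b j)

/-- Winners-pay utility of bidder `i` with private values `v` at the bid vector `b`. -/
noncomputable def utility {n : ℕ} (c : ℝ) (v b : Fin n → ℝ) (i : Fin n) : ℝ :=
  (v i - b i) * alloc c b i

/-- `x` is a best response of bidder `i` to the bids of the others in `b`: among all
nonnegative bids of bidder `i`, the bid `x` maximizes the utility of bidder `i`. The value
`b i` plays no role. -/
def IsBestResponse {n : ℕ} (c : ℝ) (v b : Fin n → ℝ) (i : Fin n) (x : ℝ) : Prop :=
  0 ≤ x ∧ ∀ y : ℝ, 0 ≤ y →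
    utility c v (Function.update b i y) i ≤ utility c v (Function.update b i x) i

/-- The vector of best responses to `b`. Where the best response exists and is unique, this is
that best response. -/
noncomputable def BR {n : ℕ} (c : ℝ) (v b : Fin n → ℝ) : Fin n → ℝ :=
  fun i => Classical.epsilon (IsBestResponse c v b i)

/-- `b` is a pure-strategy Nash equilibrium: a vector of nonnegative bids at which no bidder
can increase their utility by a unilateral change to another nonnegative bid. -/
def IsPureNash {n : ℕ} (c : ℝ) (v b : Fin n → ℝ) : Prop :=
  ∀ i, 0 ≤ b i ∧ ∀ y : ℝ, 0 ≤ y → utility c v (Function.update b i y) i ≤ utility c v b i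

end QuasiProportional

namespace QuasiProportional

/-! Against total weight `S > 0` of the others, the derivative of a bidder's payoff at `y ≥ 0` has
the sign of `v - focValue c S y`. Since `focValue` is strictly increasing in the bid, the payoff has
a single peak, where `focValue = v` (`payoff_lt_payoff`, `isBestResponse_iff`). Since `focValue`
decreases in `S`, higher bids by the others raise the best response (`BR_mono`). The hypothesis on
`w` says `focValue ≤ v` at `w`, which keeps best responses above `w`; `y ≤ focValue c S y` keeps
them below `v`. So `BR` is a monotone self-map of a box, and Knaster–Tarski gives a fixed point. -/

/-- The utility of a bidder with value `v` and bid `y` against total weight `S` of the others. -/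
noncomputable def payoff (c v S y : ℝ) : ℝ := (v - y) * (weight c y / (weight c y + S))

/-- The value at which bidding `y` satisfies the first-order condition against total weight `S` of
the others. -/
noncomputable def focValue (c S y : ℝ) : ℝ :=
  y + (1 / c) * (1 - 1 / Real.exp (c * y)) * ((weight c y + S) / S)

/-- The total weight of the bids of the bidders other than `i`. -/
noncomputable def othersWeight {n : ℕ} (c : ℝ) (b : Fin n → ℝ) (i : Fin n) : ℝ :=
  ∑ j ∈ Finset.univ.erase i, weight c (b j)

lemma weight_mono {c : ℝ} (hc : 0 < c) : Monotone (weight c) := fun x y h => by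
  unfold weight; gcongr

lemma weight_zero (c : ℝ) : weight c 0 = 0 := by simp [weight]

lemma weight_nonneg {c x : ℝ} (hc : 0 < c) (hx : 0 ≤ x) : 0 ≤ weight c x :=
  weight_zero c ▸ weight_mono hc hx

lemma weight_pos {c x : ℝ} (hc : 0 < c) (hx : 0 < x) : 0 < weight c x := by
  have : 1 < Real.exp (c * x) := Real.one_lt_exp_iff.2 (by positivity)
  unfold weight; linarith

lemma hasDerivAt_weight (c x : ℝ) : HasDerivAt (weight c) (c * Real.exp (c * x)) x := by
  have h := (((hasDerivAt_id x).const_mul c).exp).sub_const 1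
  simp only [id, mul_one] at h
  rw [mul_comm]
  exact h

lemma othersWeight_mono {n : ℕ} {c : ℝ} (hc : 0 < c) (i : Fin n) :
    Monotone fun b : Fin n → ℝ => othersWeight c b i := fun _ _ h =>
  Finset.sum_le_sum fun j _ => weight_mono hc (h j)

/-- With two positive bids, one remains after any single bidder is removed. -/
lemma othersWeight_pos {n : ℕ} {c : ℝ} (hc : 0 < c) {b : Fin n → ℝ} (hb : ∀ i, 0 ≤ b i)
    (htwo : ∃ i j, i ≠ j ∧ 0 < b i ∧ 0 < b j) (i : Fin n) : 0 < othersWeight c b i := by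
  have key : ∀ k, k ≠ i → 0 < b k → 0 < othersWeight c b i := fun k hk hpos =>
    Finset.sum_pos' (fun j _ => weight_nonneg hc (hb j))
      ⟨k, Finset.mem_erase.2 ⟨hk, Finset.mem_univ k⟩, weight_pos hc hpos⟩
  obtain ⟨j, k, hjk, hj, hk⟩ := htwo
  by_cases h : j = i
  · exact key k (fun h' => hjk (h.trans h'.symm)) hk
  · exact key j h hj

lemma sum_weight_eq {n : ℕ} (c : ℝ) (b : Fin n → ℝ) (i : Fin n) :
    ∑ j, weight c (b j) = weight c (b i) + othersWeight c b i :=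
  (Finset.add_sum_erase _ _ (Finset.mem_univ i)).symm

lemma utility_eq_payoff {n : ℕ} (c : ℝ) (v b : Fin n → ℝ) (i : Fin n) :
    utility c v b i = payoff c (v i) (othersWeight c b i) (b i) := by
  rw [utility, alloc, sum_weight_eq c b i, payoff]

lemma othersWeight_update {n : ℕ} (c : ℝ) (b : Fin n → ℝ) (i : Fin n) (y : ℝ) :
    othersWeight c (Function.update b i y) i = othersWeight c b i :=
  Finset.sum_congr rfl fun j hj => by
    rw [Function.update_of_ne (Finset.ne_of_mem_erase hj)]

lemma utility_update_eq_payoff {n : ℕ} (c : ℝ) (v b : Fin n → ℝ) (i : Fin n) (y : ℝ) :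
    utility c v (Function.update b i y) i = payoff c (v i) (othersWeight c b i) y := by
  rw [utility_eq_payoff, othersWeight_update, Function.update_self]

lemma one_sub_inv_exp_nonneg {c y : ℝ} (hc : 0 < c) (hy : 0 ≤ y) :
    0 ≤ 1 - 1 / Real.exp (c * y) := by
  rw [sub_nonneg, div_le_one (Real.exp_pos _)]
  exact Real.one_le_exp (by positivity)

lemma le_focValue {c S y : ℝ} (hc : 0 < c) (hS : 0 < S) (hy : 0 ≤ y) : y ≤ focValue c S y := by
  have h1 := one_sub_inv_exp_nonneg hc hy
  have h2 := weight_nonneg hc hy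
  have : 0 ≤ (1 / c) * (1 - 1 / Real.exp (c * y)) * ((weight c y + S) / S) := by positivity
  unfold focValue; linarith

lemma focValue_strictMonoOn {c S : ℝ} (hc : 0 < c) (hS : 0 < S) :
    StrictMonoOn (focValue c S) (Set.Ici 0) := by
  intro x hx y hy hxy
  have h1 := one_sub_inv_exp_nonneg hc hy
  have h2 := weight_nonneg hc hx
  have h3 := weight_mono hc hxy.le
  have h4 : 1 / Real.exp (c * y) ≤ 1 / Real.exp (c * x) := by gcongr
  unfold focValue
  refine add_lt_add_of_lt_of_le hxy ?_
  gcongr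

/-- The last factor is `1 + weight c y / S`, decreasing in `S`; the other factors are nonnegative
and free of `S`. -/
lemma focValue_antitone {c S T y : ℝ} (hc : 0 < c) (hS : 0 < S) (hST : S ≤ T) (hy : 0 ≤ y) :
    focValue c T y ≤ focValue c S y := by
  have h1 := one_sub_inv_exp_nonneg hc hy
  have h2 := weight_nonneg hc hy
  have h3 : (weight c y + T) / T ≤ (weight c y + S) / S := by
    rw [add_div, add_div, div_self hS.ne', div_self (hS.trans_le hST).ne']
    gcongr
  unfold focValue
  gcongr

lemma continuous_focValue (c S : ℝ) : Continuous (focValue c S) := by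
  have : ∀ y, Real.exp (c * y) ≠ 0 := fun y => (Real.exp_pos _).ne'
  unfold focValue weight
  fun_prop (disch := assumption)

/-- Intermediate value theorem: `focValue` is `0` at `0` and at least `v` at `v`. -/
lemma exists_focValue_eq {c S v : ℝ} (hc : 0 < c) (hS : 0 < S) (hv : 0 ≤ v) :
    ∃ y ∈ Set.Icc 0 v, focValue c S y = v :=
  intermediate_value_Icc hv (continuous_focValue c S).continuousOn
    ⟨by simpa [focValue] using hv, le_focValue hc hS hv⟩

/-- With `F = weight c`, factoring `F' S / (F + S)^2` out of the product rule leaves `v - y - (F /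
F') (F + S) / S`, and `F / F' = (1 - e^{-cy}) / c`. -/
lemma hasDerivAt_payoff {c v S y : ℝ} (hc : 0 < c) (hS : 0 < S) (hy : 0 ≤ y) :
    HasDerivAt (payoff c v S)
      (c * Real.exp (c * y) * S / (weight c y + S) ^ 2 * (v - focValue c S y)) y := by
  have hne : weight c y + S ≠ 0 := (add_pos_of_nonneg_of_pos (weight_nonneg hc hy) hS).ne'
  have hF := hasDerivAt_weight c y
  have h := ((hasDerivAt_id y).const_sub v).mul (hF.div (hF.add_const S) hne)
  refine h.congr_deriv ?_
  -- Eliminating the exponential makes the identity rational in `weight c y`.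
  have hE : Real.exp (c * y) = weight c y + 1 := by simp [weight]
  have hE' : weight c y + 1 ≠ 0 := by rw [← hE]; exact (Real.exp_pos _).ne'
  simp only [focValue, id, Pi.div_apply, hE]
  field_simp
  ring

lemma payoff_lt_payoff {c v S x y : ℝ} (hc : 0 < c) (hS : 0 < S) (hx : 0 ≤ x)
    (hxv : focValue c S x = v) (hy : 0 ≤ y) (hyx : y ≠ x) :
    payoff c v S y < payoff c v S x := by
  have hcont : ContinuousOn (payoff c v S) (Set.Ici 0) := fun z hz =>
    (hasDerivAt_payoff hc hS hz).continuousAt.continuousWithinAt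
  have hfac : ∀ z, 0 ≤ z → 0 < c * Real.exp (c * z) * S / (weight c z + S) ^ 2 := fun z hz => by
    have := weight_nonneg hc hz
    positivity
  rcases lt_or_gt_of_ne hyx with h | h
  · refine strictMonoOn_of_deriv_pos (convex_Icc 0 x) (hcont.mono Set.Icc_subset_Ici_self) ?_
      ⟨hy, h.le⟩ ⟨hx, le_rfl⟩ h
    intro z hz
    rw [interior_Icc] at hz
    rw [(hasDerivAt_payoff hc hS hz.1.le).deriv]
    refine mul_pos (hfac z hz.1.le) (sub_pos.2 ?_)
    exact hxv ▸ focValue_strictMonoOn hc hS hz.1.le hx hz.2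
  · refine strictAntiOn_of_deriv_neg (convex_Ici x) (hcont.mono (Set.Ici_subset_Ici.2 hx)) ?_
      Set.self_mem_Ici h.le h
    intro z hz
    rw [interior_Ici] at hz
    have hz0 : 0 ≤ z := hx.trans (le_of_lt hz)
    rw [(hasDerivAt_payoff hc hS hz0).deriv]
    refine mul_neg_of_pos_of_neg (hfac z hz0) (sub_neg.2 ?_)
    exact hxv ▸ focValue_strictMonoOn hc hS hx hz0 hz

/-- For `v i ≥ 0` the first-order equation has a root, which strictly beats every other bid; hence
the equation holds even for a best response at the boundary `0`. -/
lemma isBestResponse_iff {n : ℕ} {c : ℝ} {v b : Fin n → ℝ} {i : Fin n} {x : ℝ} (hc : 0 < c)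
    (hS : 0 < othersWeight c b i) (hv : 0 ≤ v i) :
    IsBestResponse c v b i x ↔ 0 ≤ x ∧ focValue c (othersWeight c b i) x = v i := by
  simp only [IsBestResponse, utility_update_eq_payoff]
  refine ⟨fun ⟨hx, hmax⟩ => ⟨hx, ?_⟩, fun ⟨hx, hxv⟩ => ⟨hx, fun y hy => ?_⟩⟩
  · obtain ⟨z, hz, hzv⟩ := exists_focValue_eq hc hS hv
    by_contra hne
    have hxz : x ≠ z := fun h => hne (h ▸ hzv)
    exact (payoff_lt_payoff hc hS hz.1 hzv hx hxz).not_ge (hmax z hz.1)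
  · rcases eq_or_ne y x with rfl | hyx
    · exact le_rfl
    · exact (payoff_lt_payoff hc hS hx hxv hy hyx).le

lemma existsUnique_isBestResponse {n : ℕ} {c : ℝ} {v b : Fin n → ℝ} {i : Fin n} (hc : 0 < c)
    (hS : 0 < othersWeight c b i) (hv : 0 ≤ v i) : ∃! x, IsBestResponse c v b i x := by
  simp only [isBestResponse_iff hc hS hv]
  obtain ⟨z, hz, hzv⟩ := exists_focValue_eq hc hS hv
  exact ⟨z, ⟨hz.1, hzv⟩, fun y hy =>
    (focValue_strictMonoOn hc hS).injOn hy.1 hz.1 (hy.2.trans hzv.symm)⟩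

lemma isBestResponse_BR {n : ℕ} {c : ℝ} {v b : Fin n → ℝ} {i : Fin n}
    (h : ∃ x, IsBestResponse c v b i x) : IsBestResponse c v b i (BR c v b i) :=
  Classical.epsilon_spec h

lemma isPureNash_of_BR_eq {n : ℕ} {c : ℝ} {v b : Fin n → ℝ}
    (h : ∀ i, ∃ x, IsBestResponse c v b i x) (hb : BR c v b = b) : IsPureNash c v b := fun i => by
  have := isBestResponse_BR (h i)
  rw [hb] at this
  simpa only [IsBestResponse, Function.update_eq_self] using this

/-- Identifies the bound assumed on `w` with a bound on `focValue`. -/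
lemma inv_one_sub_alloc {n : ℕ} {c : ℝ} {b : Fin n → ℝ} {i : Fin n} (hc : 0 < c) (hb : 0 ≤ b i)
    (hS : 0 < othersWeight c b i) :
    1 / (1 - alloc c b i) = (weight c (b i) + othersWeight c b i) / othersWeight c b i := by
  have hne := (add_pos_of_nonneg_of_pos (weight_nonneg hc hb) hS).ne'
  rw [alloc, sum_weight_eq c b i, one_sub_div hne, add_sub_cancel_left, one_div_div]

lemma BR_mono {n : ℕ} {c : ℝ} {v b b' : Fin n → ℝ} {i : Fin n} (hc : 0 < c)
    (hS : 0 < othersWeight c b i) (hv : 0 ≤ v i) (hbb' : b ≤ b') :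
    BR c v b i ≤ BR c v b' i := by
  have hST := othersWeight_mono hc i hbb'
  have hT : 0 < othersWeight c b' i := hS.trans_le hST
  obtain ⟨h0, h1⟩ := (isBestResponse_iff hc hS hv).1
    (isBestResponse_BR (existsUnique_isBestResponse hc hS hv).exists)
  obtain ⟨h0', h1'⟩ := (isBestResponse_iff hc hT hv).1
    (isBestResponse_BR (existsUnique_isBestResponse hc hT hv).exists)
  refine (focValue_strictMonoOn hc hT).le_iff_le h0 h0' |>.1 ?_
  rw [h1', ← h1]
  exact focValue_antitone hc hS hST h0

/-- Knaster–Tarski for a box in `ι → ℝ`. -/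
lemma exists_fixedPoint_of_monotoneOn_Icc {ι : Type*} {w v : ι → ℝ} (hwv : w ≤ v)
    {F : (ι → ℝ) → ι → ℝ} (hF : MonotoneOn F (Set.Icc w v))
    (hmaps : Set.MapsTo F (Set.Icc w v) (Set.Icc w v)) : ∃ b ∈ Set.Icc w v, F b = b := by
  -- Nonemptiness makes each interval, hence their product, a complete lattice.
  have : ∀ i, Fact (w i ≤ v i) := fun i => ⟨hwv i⟩
  have hmem : ∀ b : (i : ι) → Set.Icc (w i) (v i), (fun i => (b i : ℝ)) ∈ Set.Icc w v :=
    fun b => ⟨fun i => (b i).2.1, fun i => (b i).2.2⟩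
  let G : ((i : ι) → Set.Icc (w i) (v i)) →o ((i : ι) → Set.Icc (w i) (v i)) :=
    { toFun := fun b i =>
        ⟨F (fun j => b j) i, (hmaps (hmem b)).1 i, (hmaps (hmem b)).2 i⟩
      monotone' := fun b b' h i => hF (hmem b) (hmem b') (fun j => h j) i }
  refine ⟨fun i => G.lfp i, hmem _, funext fun i => ?_⟩
  exact congrArg Subtype.val (congrFun G.map_lfp i)

end QuasiProportional

open QuasiProportional in
theorem theorem4 (n : ℕ) (c : ℝ) (hc : 0 < c) (v w : Fin n → ℝ)
    (hw_nonneg : ∀ i, 0 ≤ w i)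
    (hw_two : ∃ i j, i ≠ j ∧ 0 < w i ∧ 0 < w j)
    (hw : ∀ i, w i ≤ v i -
      (1 / c) * (1 - 1 / Real.exp (c * w i)) * (1 / (1 - QuasiProportional.alloc c w i))) :
    (∀ b ∈ Set.Icc w v, ∀ i, ∃! x, QuasiProportional.IsBestResponse c v b i x) ∧
    ∃ b ∈ Set.Icc w v, QuasiProportional.BR c v b = b ∧ QuasiProportional.IsPureNash c v b := by
  have hSw : ∀ i, 0 < othersWeight c w i := othersWeight_pos hc hw_nonneg hw_two
  have hfoc : ∀ i, focValue c (othersWeight c w i) (w i) ≤ v i := fun i => by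
    have := hw i
    rw [inv_one_sub_alloc hc (hw_nonneg i) (hSw i)] at this
    unfold focValue
    linarith
  have hwv : w ≤ v := fun i => (le_focValue hc (hSw i) (hw_nonneg i)).trans (hfoc i)
  have hv : ∀ i, 0 ≤ v i := fun i => (hw_nonneg i).trans (hwv i)
  have hS : ∀ b ∈ Set.Icc w v, ∀ i, 0 < othersWeight c b i := fun b hb i =>
    (hSw i).trans_le (othersWeight_mono hc i hb.1)
  have huniq : ∀ b ∈ Set.Icc w v, ∀ i, ∃! x, IsBestResponse c v b i x := fun b hb i =>
    existsUnique_isBestResponse hc (hS b hb i) (hv i)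
  have hBR : ∀ b ∈ Set.Icc w v, ∀ i,
      0 ≤ BR c v b i ∧ focValue c (othersWeight c b i) (BR c v b i) = v i := fun b hb i =>
    (isBestResponse_iff hc (hS b hb i) (hv i)).1 (isBestResponse_BR (huniq b hb i).exists)
  have hmaps : Set.MapsTo (BR c v) (Set.Icc w v) (Set.Icc w v) := fun b hb => by
    refine ⟨fun i => ?_, fun i =>
      (le_focValue hc (hS b hb i) (hBR b hb i).1).trans_eq (hBR b hb i).2⟩
    -- The others bid at least `w`, so `focValue` at `w i` is no larger than against `w` itself,
    -- hence at most `v i`.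
    refine (focValue_strictMonoOn hc (hS b hb i)).le_iff_le (hw_nonneg i) (hBR b hb i).1 |>.1 ?_
    rw [(hBR b hb i).2]
    exact (focValue_antitone hc (hSw i) (othersWeight_mono hc i hb.1) (hw_nonneg i)).trans (hfoc i)
  obtain ⟨b, hb, hfix⟩ := exists_fixedPoint_of_monotoneOn_Icc hwv (F := BR c v)
    (fun b hb b' _ hbb' i => BR_mono hc (hS b hb i) (hv i) hbb') hmaps
  exact ⟨huniq, b, hb, hfix, isPureNash_of_BR_eq (fun i => (huniq b hb i).exists) hfix⟩
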